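/- Let $(R,\mathfrak m)$ be a regular local ring of dimension $n$, let $r\ge 2$ with $n\ge r+1$, and let $I\subset R$ be a generalized Cohen–Macaulay ideal of codimension $r$ (i.e. $\operatorname{height} I=r$ and $H^i_{\mathfrak m}(R/I)$ has finite length for all $i<\dim R/I$). For an $R$-module $X$ let $\Omega_i(X)$ be its $i$-th syzygy in a minimal free resolution. Let $M_i$ $(0\le i\le n-r-1)$ and $N_i$ $(n-r+2\le i\le n-1)$ be $R$-modules of finite length, put $$M=\bigoplus_{i=0}^{n-r-1}\Omega_{i+1}(M_i),\qquad N=\bigoplus_{i=n-r+2}^{n-1}\Omega_i(N_i),$$ and assume $N\ne 0$. Let $$0\to F_{r-1}\to\cdots\to F_1\xrightarrow{\,g\,}M\oplus N\xrightarrow{\,\phi\,}I\to 0\qquad(*)$$ be an exact sequence with all $F_j$ free of finite rank. Let $U_\bullet\xrightarrow{\epsilon}M$ and $V_\bullet\xrightarrow{\eta}N$ be minimal free resolutions. The sequence $(*)$ is of *trivial type* if it is the direct sum of an exact sequence $0\to F'_{r-1}\to\cdots\to F'_1\to M\to I\to 0$ with $F'_j$ free of finite rank and of the truncated minimal free resolutions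 $0\to G^{(i)}_n\to\cdots\to G^{(i)}_i\to\Omega_i(N_i)\to 0$ $(n-r+2\le i\le n-1)$, where $G^{(i)}_\bullet$ is a minimal free resolution of $N_i$; that is, there are isomorphisms of the free modules which, together with the identity maps of $M\oplus N$ and $I$, identify $(*)$ with this direct sum. Otherwise $(*)$ is of *non-trivial type*. A *b-sequence of $(*)$* is a sequence $\beta_1,\dots,\beta_q\in (U_0\oplus V_0)\setminus\operatorname{Ker}(\epsilon\oplus\eta)$ such that for some free basis $m_1,\dots,m_q$ of $F_1$ we have $(\epsilon\oplus\eta)(\beta_i)=g(m_i)$ for all $i$ and, with $\varphi=\phi\circ(\epsilon\oplus\eta):U_0\oplus V_0\to R$ and $\beta:F_1\to U_0\oplus V_0$, $m_i\mapsto\beta_i$, * $\operatorname{Ker}\varphi=\langle\beta_1,\dots,\beta_q\rangle+\operatorname{Ker}(\epsilon\oplus\eta)$; * $\beta(\operatorname{Ker} g)=\langle\beta_1,\dots,\beta_q\rangle\cap\operatorname{Ker}(\epsilon\oplus\eta)$, and $\operatorname{Ker}\beta\subset\operatorname{Ker} g$. **Theorem.** The sequence $(*)$ is of non-trivial type if and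 only if 1. there exists a b-sequence $\{\beta_i\}_i\subset U_0\oplus V_0$ of $(*)$, and 2. for every b-sequence $\{\beta_i\}_i$ of $(*)$, the submodule $\langle\{\beta_i\}_i\rangle$ of $U_0\oplus V_0$ cannot be decomposed as $A\oplus B$ with $0\ne A\subset U_0$ and $0\ne B\subset V_0$. -/

import Mathlib

open IsLocalRing

universe u v w

namespace BSeq

/-- A minimal free resolution `⋯ → R^{rank 1} → R^{rank 0} → M → 0` of a (finitely generated) module
`M` over a local ring: an exact complex of finite free modules all of whose differentials have
entries in the maximal ideal. -/
structure MinimalFreeResolution (R : Type u) [CommRing R] [IsLocalRing R]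
    (M : Type v) [AddCommGroup M] [Module R M] where
  rank : ℕ → ℕ
  d : ∀ k, (Fin (rank (k + 1)) → R) →ₗ[R] (Fin (rank k) → R)
  aug : (Fin (rank 0) → R) →ₗ[R] M
  aug_surjective : Function.Surjective aug
  exact_aug : Function.Exact (d 0) aug
  exact_d : ∀ k, Function.Exact (d (k + 1)) (d k)
  minimal : ∀ k, LinearMap.range (d k) ≤ maximalIdeal R • ⊤

namespace MinimalFreeResolution

variable {R : Type u} [CommRing R] [IsLocalRing R] {M : Type v} [AddCommGroup M] [Module R M]

/-- The free module in degree `k` of the resolution. -/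
abbrev F (G : MinimalFreeResolution R M) (k : ℕ) : Type u := Fin (G.rank k) → R

/-- The `k`-th syzygy module `Ω_k(M)`, as the cokernel of `G_{k+1} → G_k`. It is canonically `M`
for `k = 0` (`syzygyZeroEquiv`) and the image of `G_k → G_{k-1}` for `k ≥ 1`
(`syzygySuccEquiv`). -/
abbrev Syzygy (G : MinimalFreeResolution R M) (k : ℕ) : Type u :=
  G.F k ⧸ LinearMap.range (G.d k)

/-- The canonical surjection `G_k → Ω_k(M)`. -/
abbrev toSyzygy (G : MinimalFreeResolution R M) (k : ℕ) : G.F k →ₗ[R] G.Syzygy k :=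
  (LinearMap.range (G.d k)).mkQ

noncomputable def syzygyZeroEquiv (G : MinimalFreeResolution R M) : G.Syzygy 0 ≃ₗ[R] M :=
  (Submodule.quotEquivOfEq _ _ (LinearMap.exact_iff.mp G.exact_aug).symm).trans
    (G.aug.quotKerEquivOfSurjective G.aug_surjective)

noncomputable def syzygySuccEquiv (G : MinimalFreeResolution R M) (k : ℕ) :
    G.Syzygy (k + 1) ≃ₗ[R] LinearMap.range (G.d k) :=
  (Submodule.quotEquivOfEq _ _ (LinearMap.exact_iff.mp (G.exact_d k)).symm).trans
    (G.d k).quotKerEquivRange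

end MinimalFreeResolution

/-- A long Bourbaki sequence of length `r`,
`0 → F_{r-1} → ⋯ → F_2 → F_1 --g--> P --φ--> I → 0`,
i.e. an exact sequence with `I` an ideal and all `F_j` free of finite rank. The module `F_{j+1}` is
`R^{rank j}`; the modules `F_j` with `j ≥ r` are zero. -/
structure BourbakiSequence (R : Type u) [CommRing R] (r : ℕ)
    (P : Type v) [AddCommGroup P] [Module R P] (I : Ideal R) where
  rank : ℕ → ℕ
  rank_eq_zero : ∀ j, r ≤ j + 1 → rank j = 0
  d : ∀ j, (Fin (rank (j + 1)) → R) →ₗ[R] (Fin (rank j) → R)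
  g : (Fin (rank 0) → R) →ₗ[R] P
  φ : P →ₗ[R] I
  exact_d : ∀ j, Function.Exact (d (j + 1)) (d j)
  exact_g : Function.Exact (d 0) g
  exact_φ : Function.Exact g φ
  φ_surjective : Function.Surjective φ

/-- `(β, φ)` is a b-sequence for the pair `(f : F → G, M)`, where `ε : U → M` is a presentation
of `M` by a finite free module and `m` is the basis of the free module `G` used in forming the map
`G → U`, `m i ↦ β i` (below: `m.constr ℕ β`).
The last two fields say that the commutative diagram with columns
`F → ⟨β⟩ ∩ Ker ε → 0` and `G → ⟨β⟩ → 0` has exact columns, and that `f` identifies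
the kernels of the two columns. -/
structure IsBSequence {R : Type*} [CommRing R] {U M F G : Type*}
    [AddCommGroup U] [Module R U] [AddCommGroup M] [Module R M]
    [AddCommGroup F] [Module R F] [AddCommGroup G] [Module R G]
    (ε : U →ₗ[R] M) (f : F →ₗ[R] G) {q : ℕ} (m : Module.Basis (Fin q) R G)
    (β : Fin q → U) (φ : U →ₗ[R] R) : Prop where
  f_injective : Function.Injective f
  not_mem : ∀ i, β i ∉ LinearMap.ker ε
  ker_eq : LinearMap.ker φ = Submodule.span R (Set.range β) ⊔ LinearMap.ker ε
  range_comp : LinearMap.range (m.constr ℕ β ∘ₗ f) =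
    Submodule.span R (Set.range β) ⊓ LinearMap.ker ε
  map_ker : (LinearMap.ker (m.constr ℕ β ∘ₗ f)).map f = LinearMap.ker (m.constr ℕ β)

/-- `β` is a b-sequence of the given Bourbaki sequence, with respect to the presentation
`ε : U → P`: for some basis `m` of `F_1`, the elements `β i` lift the elements `g (m i)`, and `β`
together with the lift `φ ∘ ε : U → R` of `φ` is a b-sequence for `(Ker g ↪ F_1, P)`. -/
def BourbakiSequence.IsBSequence {R : Type u} [CommRing R] {r : ℕ}
    {P : Type v} [AddCommGroup P] [Module R P] {I : Ideal R} (S : BourbakiSequence R r P I)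
    {U : Type*} [AddCommGroup U] [Module R U] (ε : U →ₗ[R] P) {q : ℕ} (β : Fin q → U) : Prop :=
  ∃ m : Module.Basis (Fin q) R (Fin (S.rank 0) → R),
    (∀ i, ε (β i) = S.g (m i)) ∧
    BSeq.IsBSequence ε (LinearMap.ker S.g).subtype m β (I.subtype ∘ₗ S.φ ∘ₗ ε)

/-- A submodule `L` of `U × V` splits as `A ⊕ B` with nonzero `A ⊆ U` and nonzero `B ⊆ V`. -/
def SplitsNontrivially {R : Type*} [CommRing R] {U V : Type*}
    [AddCommGroup U] [Module R U] [AddCommGroup V] [Module R V]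
    (L : Submodule R (U × V)) : Prop :=
  ∃ (A : Submodule R U) (B : Submodule R V), A ≠ ⊥ ∧ B ≠ ⊥ ∧ L = A.prod B

/-- A Bourbaki sequence with middle module `M ⊕ ⨁ᵢ Ω_{t i}(N i)` is of trivial type if it is the
direct sum of a Bourbaki sequence `0 → F'_{r-1} → ⋯ → F'_1 → M → I → 0` and the truncated minimal
resolutions `⋯ → G^i_{t i + 1} → G^i_{t i} → Ω_{t i}(N i) → 0`: there are isomorphisms
`e j : F_{j+1} ≅ F'_{j+1} ⊕ ⨁ᵢ G^i_{t i + j}` which, together with the identities of the middle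
module and of `I`, form an isomorphism of complexes. -/
def BourbakiSequence.IsTrivialType {R : Type u} [CommRing R] [IsLocalRing R] {r : ℕ}
    {M : Type u} [AddCommGroup M] [Module R M] {I : Ideal R}
    {ι : Type} {N : ι → Type v} [∀ i, AddCommGroup (N i)] [∀ i, Module R (N i)]
    (G : ∀ i, MinimalFreeResolution R (N i)) (t : ι → ℕ)
    (S : BourbakiSequence R r (M × (∀ i, (G i).Syzygy (t i))) I) : Prop :=
  ∃ (T : BourbakiSequence R r M I)
    (e : ∀ j, (Fin (S.rank j) → R) ≃ₗ[R]
      (Fin (T.rank j) → R) × (∀ i, (G i).F (t i + j))),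
    (∀ j x, e j (S.d j x) =
      (T.d j (e (j + 1) x).1, fun i => (G i).d (t i + j) ((e (j + 1) x).2 i))) ∧
    (∀ x, S.g x = (T.g (e 0 x).1, fun i => (G i).toSyzygy (t i) ((e 0 x).2 i))) ∧
    (∀ y, S.φ y = T.φ y.1)

/-- `I` is a generalized Cohen–Macaulay ideal of codimension `r` in the local ring `R`: it has
height `r`, and the local cohomology modules `H^i_𝔪(R/I)` with `i < dim R/I` have finite length. -/
structure IsGeneralizedCM {R : Type u} [CommRing R] [IsLocalRing R] (I : Ideal R) (r : ℕ) :
    Prop where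
  height_eq : I.height = r
  finite_length : ∀ i : ℕ, (i : WithBot ℕ∞) < ringKrullDim (R ⧸ I) →
    IsFiniteLength R ((localCohomology (maximalIdeal R) i).obj (ModuleCat.of R (R ⧸ I)))

end BSeq

/-!
The exactness conditions in the definition of a b-sequence of `(*)` follow from the one equation
`(ε ⊕ η) ∘ β = g`. Hence a b-sequence is a lift of `g` to `U₀ ⊕ V₀` together with a basis of `F₁` on
which `g` does not vanish; such a basis exists as soon as `g ≠ 0`
(`BSeq.BourbakiSequence.exists_isBSequence_of_lift`), and the span of the `β i` is the image of the
lift. So the claim is that `g ≠ 0` and that `(*)` is of trivial type if and only if some lift of `g`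
has an image `A ⊕ B` with `0 ≠ A ⊆ U₀` and `0 ≠ B ⊆ V₀`.

*`g ≠ 0`.* Otherwise `M ⊕ N ≅ I`. The module `M ⊕ N` is free on the punctured spectrum, being made
of syzygies of modules of finite length, whereas an ideal of height between `2` and `dim R - 1` is
not: at a minimal prime it would be principal, against Krull's theorem
(`Module.IsFreeOnPuncturedSpectrum.false_of_ideal`). In the same way `M → I` is no isomorphism.

*Trivial type gives a lift whose image splits.* Lift the two summands separately; `A ≠ 0` because
`F'₁ → M` is nonzero by the previous point, and `B ≠ 0` because `N ≠ 0`.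

*Conversely*, if the image of a lift is `A ⊕ B`, then `ker φ = ε(A) ⊕ η(B)`. As `R` is a domain, `φ`
vanishes on `M` or on `N`
(`BSeq.forall_eq_zero_or_forall_eq_zero_of_ker_eq_prod`).
If `φ` vanishes on `N`, then `ker φ = M' ⊕ N`, and the minimal resolution of `N` splits off from the
resolution `F_•` of `ker φ` (`exists_linearEquiv_prod_of_exact`), so `(*)` is of trivial type.
If `φ` vanishes on `M`, then each `Ω_{i+1}(M_i)` is a direct summand of `ker φ`, so its projective
dimension is at most `r - 2`, and that of `M_i` is at most `r - 1 + i < n`. But a nonzero module of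
finite length has projective dimension at least `n`
(`IsFiniteLength.subsingleton_of_hasProjectiveDimensionLT`), since `depth R = n`. So `M = 0` and
`U₀ = 0`, against `A ≠ 0`.
-/

/-! ### Regular local rings -/

/-- Prime avoidance in positive dimension; one of the avoided ideals, `𝔪²`, is not prime. -/
lemma IsLocalRing.exists_mem_maximalIdeal_notMem_sq_notMem_minimalPrimes
    {R : Type u} [CommRing R] [IsLocalRing R] [IsNoetherianRing R]
    (h0 : ringKrullDim R ≠ 0) :
    ∃ x ∈ maximalIdeal R, x ∉ maximalIdeal R ^ 2 ∧ ∀ p ∈ minimalPrimes R, x ∉ p := by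
  have hdim : ∀ p ∈ minimalPrimes R, ¬ maximalIdeal R ≤ p := by
    intro p hp hle
    have := hp.1.1
    have heq : maximalIdeal R = p := le_antisymm hle (le_maximalIdeal hp.1.1.ne_top)
    apply h0
    rw [← maximalIdeal_height_eq_ringKrullDim, heq, Ideal.height_eq_zero_iff.mpr hp]
    rfl
  by_contra! hcon
  have hsub : (maximalIdeal R : Set R) ⊆
      ⋃ i ∈ insert (maximalIdeal R ^ 2) (minimalPrimes R), ((id i : Ideal R) : Set R) := by
    intro x hx
    by_cases h2 : x ∈ maximalIdeal R ^ 2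
    · exact Set.mem_biUnion (Set.mem_insert _ _) h2
    · obtain ⟨p, hp, hxp⟩ := hcon x hx h2
      exact Set.mem_biUnion (Set.mem_insert_of_mem _ hp) hxp
  obtain ⟨q, hq, hle⟩ := (Ideal.subset_union_prime_finite
    ((minimalPrimes.finite_of_isNoetherianRing R).insert (maximalIdeal R ^ 2))
    (maximalIdeal R ^ 2) (maximalIdeal R ^ 2)
    (fun i hi hne _ => ((Set.mem_insert_iff.mp hi).resolve_left hne).1.1)).mp hsub
  rcases Set.mem_insert_iff.mp hq with rfl | hq
  · have hbot : maximalIdeal R = ⊥ := by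
      refine Submodule.eq_bot_of_le_smul_of_le_jacobson_bot (maximalIdeal R) _
        (IsNoetherian.noetherian _) ?_ (maximalIdeal_le_jacobson _)
      simpa [pow_two] using hle
    obtain ⟨p, hp, hle⟩ := Ideal.exists_minimalPrimes_le (bot_le : ⊥ ≤ maximalIdeal R)
    exact hdim p hp (hbot ▸ bot_le)
  · exact hdim q hq hle

/-- An element `x ∈ 𝔪 \ 𝔪²` can be exchanged into any generating set of `𝔪`, so that `𝔪 / (x)`
needs one generator fewer than `𝔪`. -/
lemma IsLocalRing.spanFinrank_maximalIdeal_quotient_add_one_le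
    {R : Type u} [CommRing R] [IsLocalRing R] [IsNoetherianRing R] {x : R}
    (hx : x ∈ maximalIdeal R) (hx2 : x ∉ maximalIdeal R ^ 2) [IsLocalRing (R ⧸ Ideal.span {x})] :
    (maximalIdeal (R ⧸ Ideal.span {x})).spanFinrank + 1 ≤ (maximalIdeal R).spanFinrank := by
  classical
  obtain ⟨S, hcard, hspan⟩ := Submodule.FG.exists_span_finset_card_eq_spanFinrank
    (IsNoetherian.noetherian (maximalIdeal R))
  have hSm : ∀ s ∈ S, s ∈ maximalIdeal R := fun s hs => hspan ▸ Submodule.subset_span hs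
  obtain ⟨c, -, hc⟩ := Submodule.mem_span_finset.mp (hspan ▸ hx)
  obtain ⟨s, hs, hcs⟩ : ∃ s ∈ S, c s ∉ maximalIdeal R := by
    by_contra! hall
    refine hx2 (hc ▸ Ideal.sum_mem _ fun s hs => ?_)
    rw [pow_two]
    exact Ideal.mul_mem_mul (hall s hs) (hSm s hs)
  have hunit : IsUnit (c s) := by simpa using hcs
  let mk := Ideal.Quotient.mk (Ideal.span {x})
  have hmap : maximalIdeal (R ⧸ Ideal.span {x}) = (maximalIdeal R).map mk := by
    have : IsLocalHom mk := .of_surjective _ Ideal.Quotient.mk_surjective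
    refine le_antisymm (fun y hy => ?_) (((local_hom_TFAE mk).out 0 2).mp this)
    obtain ⟨z, rfl⟩ := Ideal.Quotient.mk_surjective y
    exact Ideal.mem_map_of_mem mk (((mem_maximalIdeal _).mpr fun hz => hy (hz.map mk)))
  have hle : maximalIdeal (R ⧸ Ideal.span {x}) = Ideal.span (mk '' (S.erase s : Set R)) := by
    rw [hmap, ← Ideal.map_span]
    apply le_antisymm
    · rw [← hspan, Ideal.map_le_iff_le_comap]
      refine Ideal.span_le.mpr fun t ht => ?_
      by_cases hts : t = s
      · subst hts
        have h1 : c t • t + ∑ a ∈ S.erase t, c a • a = x := by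
          rw [Finset.add_sum_erase S (fun a => c a • a) hs, hc]
        have h2 : mk (c t) * mk t = - ∑ a ∈ S.erase t, mk (c a) * mk a := by
          have h3 := congrArg mk h1
          have h4 : mk x = 0 := Ideal.Quotient.eq_zero_iff_mem.mpr (Ideal.mem_span_singleton_self x)
          simp only [map_add, smul_eq_mul, map_mul, map_sum, h4] at h3
          exact eq_neg_of_add_eq_zero_left h3
        have h5 : mk (c t) * mk t ∈ (Ideal.span (S.erase t : Set R)).map mk := by
          rw [h2]
          refine neg_mem (Ideal.sum_mem _ fun a ha => Ideal.mul_mem_left _ _ ?_)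
          exact Ideal.mem_map_of_mem _ (Ideal.subset_span ha)
        exact (Ideal.unit_mul_mem_iff_mem _ (hunit.map mk)).mp h5
      · exact Ideal.mem_map_of_mem _ (Ideal.subset_span (by simpa [hts] using ht))
    · refine Ideal.map_mono (Ideal.span_le.mpr fun t ht => hSm t (Finset.mem_of_mem_erase ht))
  have hfin : (mk '' (S.erase s : Set R)).Finite := (S.erase s).finite_toSet.image _
  have h1 : (maximalIdeal (R ⧸ Ideal.span {x})).spanFinrank ≤ (S.erase s).card := by
    rw [hle]
    refine (Submodule.spanFinrank_span_le_ncard_of_finite hfin).trans ?_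
    refine (Set.ncard_image_le (S.erase s).finite_toSet).trans ?_
    rw [Set.ncard_coe_finset]
  rw [← hcard]
  have := Finset.card_erase_add_one hs
  omega

open scoped Pointwise in
/-- A regular local ring is a domain with a regular sequence of length `dim R`. By induction on the
dimension: for `x ∈ 𝔪 \ 𝔪²` outside the minimal primes, `R / (x)` is regular of dimension one less,
hence a domain; a minimal prime inside the prime `(x)` must vanish. -/
lemma isDomain_and_exists_isWeaklyRegular_of_spanFinrank_le (d : ℕ) (R : Type u) [CommRing R]
    [IsLocalRing R] [IsNoetherianRing R] (hdim : ringKrullDim R = d)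
    (hgen : (maximalIdeal R).spanFinrank ≤ d) :
    IsDomain R ∧ ∃ rs : List R, rs.length = d ∧ (∀ r ∈ rs, r ∈ maximalIdeal R) ∧
      RingTheory.Sequence.IsWeaklyRegular R rs := by
  induction d generalizing R with
  | zero =>
    have hbot : maximalIdeal R = ⊥ :=
      (Submodule.spanFinrank_eq_zero_iff_eq_bot (IsNoetherian.noetherian _)).mp (by omega)
    exact ⟨(isField_iff_maximalIdeal_eq.mpr hbot).isDomain, [], rfl, by simp, .nil R R⟩
  | succ d ih =>
    obtain ⟨x, hx, hx2, hxp⟩ :=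
      IsLocalRing.exists_mem_maximalIdeal_notMem_sq_notMem_minimalPrimes (R := R)
        (by rw [hdim]; exact_mod_cast d.succ_ne_zero)
    have hne : Ideal.span {x} ≠ ⊤ := fun h =>
      (Ideal.IsPrime.ne_top inferInstance : maximalIdeal R ≠ ⊤)
        (top_le_iff.mp (h ▸ (Ideal.span_singleton_le_iff_mem _).mpr hx))
    have : Nontrivial (R ⧸ Ideal.span {x}) := Ideal.Quotient.nontrivial_iff.mpr hne
    have : IsLocalRing (R ⧸ Ideal.span {x}) :=
      .of_surjective' (Ideal.Quotient.mk (Ideal.span {x})) Ideal.Quotient.mk_surjective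
    have hrank := IsLocalRing.spanFinrank_maximalIdeal_quotient_add_one_le hx hx2
    have hdim' : ringKrullDim (R ⧸ Ideal.span {x}) = d := by
      have h1 := ringKrullDim_le_ringKrullDim_quotient_add_card ({x} : Finset R)
        (by simpa [ringJacobson_eq_maximalIdeal] using hx)
      have h2 := ringKrullDim_le_spanFinrank_maximalIdeal (R ⧸ Ideal.span {x})
      have h3 : ringKrullDim (R ⧸ Ideal.span {x}) ≤ d :=
        h2.trans (by exact_mod_cast (show _ ≤ d by omega))
      refine le_antisymm h3 ?_
      rw [hdim] at h1
      rw [Finset.coe_singleton, Finset.card_singleton] at h1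
      generalize ringKrullDim (R ⧸ Ideal.span {x}) = e at *
      cases e with
      | bot => exact absurd (le_bot_iff.mp h1) (WithBot.coe_ne_bot)
      | coe e =>
        cases e with
        | top => exact le_top
        | coe e =>
          norm_cast at h1 ⊢
          exact Nat.le_of_add_le_add_right h1
    obtain ⟨hdom, rs, hlen, hmem, hreg⟩ := ih (R ⧸ Ideal.span {x}) hdim' (by omega)
    have hprime : (Ideal.span {x}).IsPrime := (Ideal.Quotient.isDomain_iff_prime _).mp hdom
    -- a minimal prime `p` contained in the prime `(x)` satisfies `p = x p`, so `p = 0`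
    obtain ⟨p, hp, hpx⟩ := Ideal.exists_minimalPrimes_le (bot_le : ⊥ ≤ Ideal.span {x})
    have hpp : p.IsPrime := hp.1.1
    have hp0 : p = ⊥ := by
      refine Submodule.eq_bot_of_le_smul_of_le_jacobson_bot (maximalIdeal R) _
        (IsNoetherian.noetherian _) (fun y hy => ?_) (maximalIdeal_le_jacobson _)
      obtain ⟨z, rfl⟩ := Ideal.mem_span_singleton'.mp (hpx hy)
      rw [mul_comm]
      exact Submodule.smul_mem_smul hx ((hpp.mem_or_mem hy).resolve_right (hxp p hp))
    have hR : IsDomain R := by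
      have : (⊥ : Ideal R).IsPrime := hp0 ▸ hpp
      exact IsDomain.of_bot_isPrime R
    have hx0 : x ≠ 0 := fun h => hxp p hp (h ▸ p.zero_mem)
    obtain ⟨rs', rfl⟩ : ∃ rs' : List R, rs'.map (Ideal.Quotient.mk (Ideal.span {x})) = rs :=
      List.map_surjective_iff.mpr Ideal.Quotient.mk_surjective rs
    refine ⟨hR, x :: rs', by simpa using hlen, ?_, ?_⟩
    · intro r hr
      rcases List.mem_cons.mp hr with rfl | hr
      · exact hx
      · have h := hmem _ (List.mem_map_of_mem hr)
        rw [mem_maximalIdeal, mem_nonunits_iff] at h ⊢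
        exact fun hu => h (hu.map _)
    · refine .cons' (IsSMulRegular.of_ne_zero hx0) ?_
      have hspan : Ideal.span {x} = x • (⊤ : Ideal R) := by
        ext y
        simp [Ideal.mem_span_singleton', Submodule.mem_smul_pointwise_iff_exists, mul_comm]
      let e : (R ⧸ Ideal.span {x}) ≃ₗ[R ⧸ Ideal.span {x}] QuotSMulTop x R :=
        { (Submodule.quotEquivOfEq (Ideal.span {x}) (x • ⊤) hspan) with
          map_smul' := by
            rintro ⟨a⟩ ⟨b⟩
            rfl }
      exact (e.isWeaklyRegular_congr _).mp hreg

lemma IsRegularLocalRing.isDomain_and_exists_isRegular (R : Type u) [CommRing R]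
    [IsRegularLocalRing R] {n : ℕ} (hn : ringKrullDim R = n) :
    IsDomain R ∧ ∃ rs : List R, rs.length = n ∧ (∀ r ∈ rs, r ∈ maximalIdeal R) ∧
      RingTheory.Sequence.IsRegular R rs := by
  have h := IsRegularLocalRing.spanFinrank_maximalIdeal (R := R)
  rw [hn] at h
  obtain ⟨hd, rs, hlen, hmem, hreg⟩ :=
    isDomain_and_exists_isWeaklyRegular_of_spanFinrank_le n R hn (by exact_mod_cast h.le)
  exact ⟨hd, rs, hlen, hmem, .of_isWeaklyRegular_of_mem_maximalIdeal R hmem hreg⟩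

/-! ### Projective dimension of modules of finite length -/

/-- A module of finite length over a local ring is killed by a power of each element of `𝔪`. -/
lemma IsFiniteLength.exists_pow_smul_eq_zero {R : Type u} [CommRing R] [IsLocalRing R]
    {L : Type v} [AddCommGroup L] [Module R L] (hfl : IsFiniteLength R L) {t : R}
    (ht : t ∈ maximalIdeal R) : ∃ j : ℕ, ∀ x : L, t ^ j • x = 0 := by
  obtain ⟨_, _⟩ := isFiniteLength_iff_isNoetherian_isArtinian.mp hfl
  -- the chain `t ^ j L` stabilizes, and then vanishes by Nakayama
  obtain ⟨j, hj⟩ := IsArtinian.monotone_stabilizes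
    (⟨fun j => OrderDual.toDual (LinearMap.range (LinearMap.lsmul R L (t ^ j))),
      monotone_nat_of_le_succ fun j => by
        rintro _ ⟨y, rfl⟩
        exact ⟨t • y, by simp [pow_succ, mul_smul, smul_comm t]⟩⟩ : ℕ →o (Submodule R L)ᵒᵈ)
  have hj1 : LinearMap.range (LinearMap.lsmul R L (t ^ j)) =
      LinearMap.range (LinearMap.lsmul R L (t ^ (j + 1))) :=
    OrderDual.toDual.injective (hj (j + 1) j.le_succ)
  have hbot : LinearMap.range (LinearMap.lsmul R L (t ^ j)) = ⊥ := by
    refine Submodule.eq_bot_of_le_smul_of_le_jacobson_bot (maximalIdeal R) _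
      (IsNoetherian.noetherian _) ?_ (maximalIdeal_le_jacobson _)
    conv_lhs => rw [hj1]
    rintro _ ⟨y, rfl⟩
    have h : LinearMap.lsmul R L (t ^ (j + 1)) y = t • LinearMap.lsmul R L (t ^ j) y := by
      simp [pow_succ', mul_smul]
    rw [h]
    exact Submodule.smul_mem_smul ht ⟨y, rfl⟩
  exact ⟨j, fun x => (Submodule.eq_bot_iff _).mp hbot _ ⟨x, rfl⟩⟩

open CategoryTheory Abelian in
/-- Over a ring with a regular sequence of length `n` in `𝔪`, the groups `Ext^i(k, L)` vanish for
`i ≤ n - s` when `L` is finitely generated of projective dimension less than `s`: this is the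
inequality `depth L + pd L ≥ depth R`. -/
lemma subsingleton_ext_residue_of_hasProjectiveDimensionLT
    {R : Type u} [CommRing R] [IsLocalRing R] [IsNoetherianRing R]
    {rs : List R} (hmem : ∀ r ∈ rs, r ∈ maximalIdeal R)
    (hreg : RingTheory.Sequence.IsRegular R rs)
    (s : ℕ) (L : ModuleCat.{u} R) [Module.Finite R L] (hL : HasProjectiveDimensionLT L s)
    (i : ℕ) (hi : i + s ≤ rs.length) :
    Subsingleton (Ext (ModuleCat.of R (R ⧸ maximalIdeal R)) L i) := by
  set k := ModuleCat.of R (R ⧸ maximalIdeal R)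
  have hksupp : Module.support R k ⊆ PrimeSpectrum.zeroLocus (maximalIdeal R) := by
    rw [Module.support_eq_zeroLocus]
    exact PrimeSpectrum.zeroLocus_anti_mono (by simp [k, Ideal.annihilator_quotient])
  have hzero : ∀ (X : ModuleCat.{u} R), Limits.IsZero X → ∀ j, Subsingleton (Ext k X j) :=
    fun X hX j => subsingleton_of_forall_eq 0 fun a => by
      rw [← Ext.comp_mk₀_id a, hX.eq_of_src (𝟙 X) 0, Ext.mk₀_zero, Ext.comp_zero]
  have hfree : ∀ (m j : ℕ), j < rs.length →
      Subsingleton (Ext k (ModuleCat.of R (Fin m → R)) j) := by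
    intro m j hj
    rcases Nat.eq_zero_or_pos m with rfl | hm
    · have hz : Limits.IsZero (ModuleCat.of R (Fin 0 → R)) :=
        ModuleCat.isZero_of_subsingleton _
      exact hzero _ hz j
    · have : Nonempty (Fin m) := ⟨⟨0, hm⟩⟩
      have hw : RingTheory.Sequence.IsWeaklyRegular (Fin m → R) rs :=
        ((TensorProduct.rid R (Fin m → R)).isWeaklyRegular_congr rs).mp
          hreg.toIsWeaklyRegular.isWeaklyRegular_lTensor
      refine ModuleCat.subsingleton_ext_of_exists_isRegular (maximalIdeal R) k hksupp
        (ModuleCat.of R (Fin m → R)) (lt_top_iff_ne_top.mpr fun h => ?_) rs hmem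
        (.of_isWeaklyRegular_of_mem_maximalIdeal _ hmem hw) j hj
      exact Submodule.top_ne_ideal_smul_of_le_jacobson_annihilator
        (maximalIdeal_le_jacobson _) h.symm
  induction s generalizing L i with
  | zero => exact hzero _ (isZero_of_hasProjectiveDimensionLT_zero L) i
  | succ s ih =>
    obtain ⟨m, f, hf⟩ := Module.Finite.exists_fin' R L
    have hS := LinearMap.shortExact_shortComplexKer hf
    refine subsingleton_of_forall_eq 0 fun x => ?_
    -- either way every class lifts to the free module, where there are none
    suffices ∃ y : Ext k (ModuleCat.of R (Fin m → R)) i,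
        y.comp (Ext.mk₀ (ModuleCat.ofHom f)) (add_zero i) = x by
      obtain ⟨y, rfl⟩ := this
      have := hfree m i (by omega)
      rw [Subsingleton.elim y 0, Ext.zero_comp]
    rcases Nat.eq_zero_or_pos s with rfl | hs
    · have : Projective L := projective_iff_hasProjectiveDimensionLT_one.mpr hL
      have : Epi (ModuleCat.ofHom f) := (ModuleCat.epi_iff_surjective _).mpr hf
      refine ⟨x.comp (Ext.mk₀ (Projective.factorThru (𝟙 L) (ModuleCat.ofHom f))) (add_zero i), ?_⟩
      rw [Ext.comp_assoc_of_third_deg_zero, Ext.mk₀_comp_mk₀, Projective.factorThru_comp,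
        Ext.comp_mk₀_id]
    · have hF : Projective (ModuleCat.of R (Fin m → R)) :=
        ModuleCat.projective_of_free (Pi.basisFun R (Fin m))
      have hK : HasProjectiveDimensionLT (ModuleCat.of R (LinearMap.ker f)) s :=
        hS.hasProjectiveDimensionLT_X₁ s
          (hasProjectiveDimensionLT_of_ge _ 1 s hs) hL
      have h0 := ih (ModuleCat.of R (LinearMap.ker f)) hK (i + 1) (by omega)
      exact Ext.covariant_sequence_exact₃ k hS x rfl (Subsingleton.elim (h := h0) _ _)

open CategoryTheory in
/-- A nonzero module of finite length over a ring with a regular sequence of length `n` has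
projective dimension at least `n`. -/
lemma IsFiniteLength.subsingleton_of_hasProjectiveDimensionLT
    {R : Type u} [CommRing R] [IsLocalRing R] [IsNoetherianRing R]
    {rs : List R} (hmem : ∀ r ∈ rs, r ∈ maximalIdeal R)
    (hreg : RingTheory.Sequence.IsRegular R rs)
    {L : Type u} [AddCommGroup L] [Module R L] (hfl : IsFiniteLength R L)
    (hL : HasProjectiveDimensionLT (ModuleCat.of R L) rs.length) : Subsingleton L := by
  obtain ⟨_, _⟩ := isFiniteLength_iff_isNoetherian_isArtinian.mp hfl
  have h := subsingleton_ext_residue_of_hasProjectiveDimensionLT hmem hreg _ _ hL 0 (by omega)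
  have h' : Subsingleton ((R ⧸ maximalIdeal R) →ₗ[R] L) :=
    ((Abelian.Ext.addEquiv₀ (X := ModuleCat.of R (R ⧸ maximalIdeal R))
      (Y := ModuleCat.of R L)).trans ModuleCat.homAddEquiv).symm.subsingleton
  obtain ⟨t, ht, htreg⟩ := IsSMulRegular.subsingleton_linearMap_iff.mp h'
  rw [Ideal.annihilator_quotient] at ht
  obtain ⟨j, hj⟩ := hfl.exists_pow_smul_eq_zero ht
  exact subsingleton_of_forall_eq 0 fun x =>
    (htreg.pow j) (by simpa using hj x)

/-! ### Modules that are free on the punctured spectrum -/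

/-- Multiplication by `s` on `P` factors through a finite free module. For finitely generated `P`
over a noetherian ring, some power of `s` has this property if and only if `P` becomes projective
once `s` is inverted. -/
def Module.FactorsThroughFree {R : Type u} [CommRing R] (s : R) (P : Type*) [AddCommGroup P]
    [Module R P] : Prop :=
  ∃ (F : Type u) (_ : AddCommGroup F) (_ : Module R F) (_ : Module.Free R F)
    (_ : Module.Finite R F) (a : P →ₗ[R] F) (b : F →ₗ[R] P), ∀ x, b (a x) = s • x

/-- `P` is locally free on the punctured spectrum: every `t ∈ 𝔪` has a power multiplication by which
factors through a finite free module. -/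
def Module.IsFreeOnPuncturedSpectrum (R : Type u) [CommRing R] [IsLocalRing R] (P : Type*)
    [AddCommGroup P] [Module R P] : Prop :=
  ∀ t ∈ maximalIdeal R, ∃ j : ℕ, Module.FactorsThroughFree (t ^ j) P

namespace Module

lemma FactorsThroughFree.mul {R : Type u} [CommRing R] {P : Type*} [AddCommGroup P] [Module R P]
    {s : R} (h : FactorsThroughFree s P) (c : R) : FactorsThroughFree (c * s) P := by
  obtain ⟨F, _, _, _, _, a, b, hab⟩ := h
  exact ⟨F, _, _, ‹_›, ‹_›, a, c • b, fun x => by simp [hab, mul_smul]⟩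

lemma FactorsThroughFree.prod {R : Type u} [CommRing R] {P Q : Type*} [AddCommGroup P] [Module R P]
    [AddCommGroup Q] [Module R Q] {s : R} (hP : FactorsThroughFree s P)
    (hQ : FactorsThroughFree s Q) : FactorsThroughFree s (P × Q) := by
  obtain ⟨F, _, _, _, _, a, b, hab⟩ := hP
  obtain ⟨F', _, _, _, _, a', b', hab'⟩ := hQ
  exact ⟨F × F', _, _, inferInstance, inferInstance, a.prodMap a', b.prodMap b',
    fun x => Prod.ext (hab x.1) (hab' x.2)⟩

lemma FactorsThroughFree.pi {R : Type u} [CommRing R] {ι : Type} [Finite ι] {P : ι → Type*}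
    [∀ i, AddCommGroup (P i)] [∀ i, Module R (P i)] {s : R}
    (h : ∀ i, FactorsThroughFree s (P i)) : FactorsThroughFree s (∀ i, P i) := by
  choose F _ _ _ _ a b hab using h
  exact ⟨∀ i, F i, _, _, inferInstance, inferInstance,
    LinearMap.pi fun i => a i ∘ₗ LinearMap.proj i, LinearMap.pi fun i => b i ∘ₗ LinearMap.proj i,
    fun x => funext fun i => hab i (x i)⟩

lemma FactorsThroughFree.congr {R : Type u} [CommRing R] {P Q : Type*} [AddCommGroup P]
    [Module R P] [AddCommGroup Q] [Module R Q] {s : R} (hP : FactorsThroughFree s P)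
    (e : P ≃ₗ[R] Q) : FactorsThroughFree s Q := by
  obtain ⟨F, _, _, _, _, a, b, hab⟩ := hP
  exact ⟨F, _, _, ‹_›, ‹_›, a ∘ₗ e.symm.toLinearMap, e.toLinearMap ∘ₗ b, fun x => by simp [hab]⟩

/-- If multiplication by `s` on the quotient `L ⧸ K` of a free module `L` factors through a free
module, then so does multiplication by `s` on `K`: lift `L ⧸ K → F → L ⧸ K` to `σ : L ⧸ K → L` and
use `x ↦ s x - σ x̄`, a map from `L` to `K`. -/
lemma FactorsThroughFree.of_quotient {R : Type u} [CommRing R] {L : Type u} [AddCommGroup L]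
    [Module R L] [Module.Free R L] [Module.Finite R L] {K : Submodule R L} {s : R}
    (h : FactorsThroughFree s (L ⧸ K)) : FactorsThroughFree s K := by
  obtain ⟨F, _, _, _, _, a, b, hab⟩ := h
  obtain ⟨b', hb'⟩ := Module.projective_lifting_property K.mkQ b K.mkQ_surjective
  have hmem : ∀ x, (s • LinearMap.id - b' ∘ₗ a ∘ₗ K.mkQ : L →ₗ[R] L) x ∈ K := fun x => by
    rw [← Submodule.Quotient.mk_eq_zero K, ← Submodule.mkQ_apply, LinearMap.sub_apply, map_sub]
    change K.mkQ (s • x) - (K.mkQ ∘ₗ b') (a (K.mkQ x)) = 0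
    rw [hb', hab, map_smul, sub_self]
  refine ⟨L, _, _, ‹_›, ‹_›, K.subtype, LinearMap.codRestrict K _ hmem, fun x => Subtype.ext ?_⟩
  change s • (x : L) - b' (a (K.mkQ x)) = s • (x : L)
  have h0 : K.mkQ x = 0 := (Submodule.Quotient.mk_eq_zero K).mpr x.2
  rw [h0, map_zero, map_zero, sub_zero]

lemma IsFreeOnPuncturedSpectrum.prod {R : Type u} [CommRing R] [IsLocalRing R] {P Q : Type*}
    [AddCommGroup P] [Module R P] [AddCommGroup Q] [Module R Q]
    (hP : IsFreeOnPuncturedSpectrum R P) (hQ : IsFreeOnPuncturedSpectrum R Q) :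
    IsFreeOnPuncturedSpectrum R (P × Q) := fun t ht => by
  obtain ⟨j, hj⟩ := hP t ht
  obtain ⟨l, hl⟩ := hQ t ht
  refine ⟨l + j, .prod ?_ ?_⟩
  · rw [pow_add]; exact hj.mul _
  · rw [add_comm, pow_add]; exact hl.mul _

lemma IsFreeOnPuncturedSpectrum.pi {R : Type u} [CommRing R] [IsLocalRing R] {ι : Type} [Finite ι]
    {P : ι → Type*} [∀ i, AddCommGroup (P i)] [∀ i, Module R (P i)]
    (h : ∀ i, IsFreeOnPuncturedSpectrum R (P i)) :
    IsFreeOnPuncturedSpectrum R (∀ i, P i) := fun t ht => by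
  cases nonempty_fintype ι
  choose j hj using fun i => h i t ht
  refine ⟨∑ i, j i, .pi fun i => ?_⟩
  rw [← Nat.sub_add_cancel (Finset.single_le_sum (f := j) (fun _ _ => Nat.zero_le _)
    (Finset.mem_univ i)), pow_add]
  exact (hj i).mul _

/-- An ideal which is projective near a minimal prime `p` over it is principal at `p`, so that `p`
has height at most one: if `∑ a_j(x) c_j = s x` on `I`, then `∑ a_j(c_j) = s ∉ p`, so some
`u = a_j(c_j)` is outside `p`, and `u I ⊆ (c_j)`. -/
lemma FactorsThroughFree.height_le_one {R : Type u} [CommRing R] [IsDomain R] [IsNoetherianRing R]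
    {I : Ideal R} (hI : I ≠ ⊥) {s : R} (h : FactorsThroughFree s I) {p : Ideal R}
    (hp : p ∈ I.minimalPrimes) (hs : s ∉ p) : p.height ≤ 1 := by
  obtain ⟨F, _, _, _, _, a, b, hab⟩ := h
  have hpp : p.IsPrime := hp.1.1
  let B := Module.Free.chooseBasis R F
  let c := fun j => b (B j)
  let α : Module.Free.ChooseBasisIndex R F → I →ₗ[R] R := fun j => B.coord j ∘ₗ a
  have hsum : ∀ x : I, ∑ j, α j x * (c j : R) = s * x := fun x => by
    have h1 : b (∑ j, B.repr (a x) j • B j) = s • x := by rw [B.sum_repr, hab]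
    rw [map_sum] at h1
    have h2 := congrArg I.subtype h1
    rw [map_sum] at h2
    simp only [map_smul, smul_eq_mul] at h2
    exact h2
  -- a linear form on an ideal is multiplication by a fraction
  have hcomm : ∀ (f : I →ₗ[R] R) (x y : I), f x * (y : R) = f y * (x : R) := fun f x y => by
    have h1 : (y : R) • x = (x : R) • y := Subtype.ext (mul_comm _ _)
    have h2 := congrArg f h1
    rw [map_smul, map_smul, smul_eq_mul, smul_eq_mul] at h2
    rw [mul_comm, h2, mul_comm]
  obtain ⟨y, hy, hy0⟩ := Submodule.exists_mem_ne_zero_of_ne_bot hI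
  have htrace : ∑ j, α j (c j) = s := by
    refine mul_right_cancel₀ hy0 ?_
    rw [← hsum ⟨y, hy⟩, Finset.sum_mul]
    exact Finset.sum_congr rfl fun j _ => hcomm (α j) (c j) ⟨y, hy⟩
  obtain ⟨j, hj⟩ : ∃ j, α j (c j) ∉ p := by
    by_contra! hall
    exact hs (htrace ▸ Ideal.sum_mem _ fun j _ => hall j)
  refine Ideal.height_le_one_of_isPrincipal_of_mem_minimalPrimes (Ideal.span {(c j : R)}) p
    ⟨⟨hpp, (Ideal.span_singleton_le_iff_mem _).mpr (hp.1.2 (c j).2)⟩, fun q hq hqp => ?_⟩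
  refine hp.2 ⟨hq.1, fun x hx => ?_⟩ hqp
  have h1 : α j (c j) * x ∈ q := by
    rw [hcomm (α j) (c j) ⟨x, hx⟩]
    exact q.mul_mem_left _ (hq.2 (Ideal.mem_span_singleton_self _))
  exact (hq.1.mem_or_mem h1).resolve_left fun h => hj (hqp h)

/-- An ideal `I` with `2 ≤ height I < dim R` is not free on the punctured spectrum. -/
lemma IsFreeOnPuncturedSpectrum.false_of_ideal {R : Type u} [CommRing R] [IsDomain R]
    [IsLocalRing R] [IsNoetherianRing R] {I : Ideal R} {n r : ℕ} (hn : ringKrullDim R = n)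
    (hr : 2 ≤ r) (hrn : r < n) (hI : I.height = r) (h : IsFreeOnPuncturedSpectrum R I) :
    False := by
  have hm : (maximalIdeal R).height = n := by
    have := maximalIdeal_height_eq_ringKrullDim (R := R)
    rw [hn] at this
    exact_mod_cast this
  obtain ⟨p, hp, hpm⟩ : ∃ p ∈ I.minimalPrimes, p ≠ maximalIdeal R := by
    by_contra! hall
    have h1 : (n : ℕ∞) ≤ I.height := by
      rw [Ideal.height_eq_inf_minimalPrimes]
      exact le_iInf₂ fun p hp => by rw [hall p hp, hm]
    rw [hI] at h1
    exact absurd (by exact_mod_cast h1) (not_le.mpr hrn)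
  have hpp : p.IsPrime := hp.1.1
  obtain ⟨t, ht, htp⟩ : ∃ t ∈ maximalIdeal R, t ∉ p := by
    by_contra! hall
    exact hpm (le_antisymm (le_maximalIdeal hpp.ne_top) hall)
  obtain ⟨j, hj⟩ := h t ht
  have hI0 : I ≠ ⊥ := by
    rintro rfl
    rw [Ideal.height_bot] at hI
    have : (0 : ℕ) = r := by exact_mod_cast hI
    omega
  have h1 := hj.height_le_one hI0 hp fun h => htp (hpp.mem_of_pow_mem _ h)
  have h2 : (r : ℕ∞) ≤ 1 := hI ▸ (Ideal.height_mono hp.1.2).trans h1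
  have : r ≤ 1 := by exact_mod_cast h2
  omega

end Module

namespace BSeq

lemma MinimalFreeResolution.isFreeOnPuncturedSpectrum_syzygy {R : Type u} [CommRing R]
    [IsLocalRing R] {L : Type v} [AddCommGroup L] [Module R L] (hL : IsFiniteLength R L)
    (G : MinimalFreeResolution R L) (k : ℕ) :
    Module.IsFreeOnPuncturedSpectrum R (G.Syzygy k) := fun t ht => by
  obtain ⟨j, hj⟩ := hL.exists_pow_smul_eq_zero ht
  refine ⟨j, ?_⟩
  induction k with
  | zero =>
    refine .congr ⟨PUnit, _, _, inferInstance, inferInstance, 0, 0, fun x => ?_⟩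
      G.syzygyZeroEquiv.symm
    rw [hj x, map_zero]
  | succ k ih => exact ih.of_quotient.congr (G.syzygySuccEquiv k).symm

end BSeq

/-! ### Splitting off minimal resolutions -/

/-- A minimal cover splits off. If the image of `p : F → X × Y` is a product `X' × range π`, where
`π : H → Y` is a map of free modules with kernel in `𝔪 H`, then `H` is a direct summand of `F`, and
`p` is the direct sum of `π` and of a map onto `X'` from a free module. -/
lemma exists_linearEquiv_prod_of_range_eq_prod {R : Type u} [CommRing R] [IsLocalRing R]
    [IsNoetherianRing R] {F H X Y : Type*} [AddCommGroup F] [Module R F] [AddCommGroup H]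
    [Module R H] [AddCommGroup X] [Module R X] [AddCommGroup Y] [Module R Y]
    [Module.Finite R F] [Module.Projective R F] [Module.Finite R H] [Module.Projective R H]
    (p : F →ₗ[R] X × Y) (π : H →ₗ[R] Y) (hπ : LinearMap.ker π ≤ maximalIdeal R • ⊤)
    (X' : Submodule R X) (hp : LinearMap.range p = X'.prod (LinearMap.range π)) :
    ∃ (k : ℕ) (e : F ≃ₗ[R] (Fin k → R) × H) (p' : (Fin k → R) →ₗ[R] X),
      (∀ x, p x = (p' (e x).1, π (e x).2)) ∧ LinearMap.range p' = X' := by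
  have hmem : ∀ x, (p x).1 ∈ X' ∧ (p x).2 ∈ LinearMap.range π := fun x =>
    Submodule.mem_prod.mp (hp ▸ LinearMap.mem_range_self p x)
  obtain ⟨q, hq⟩ := Module.projective_lifting_property π.rangeRestrict
    ((LinearMap.snd R X Y ∘ₗ p).codRestrict (LinearMap.range π) fun x => (hmem x).2)
    π.surjective_rangeRestrict
  have hq' : ∀ x, π (q x) = (p x).2 := fun x => congrArg Subtype.val (LinearMap.congr_fun hq x)
  obtain ⟨s, hs⟩ := Module.projective_lifting_property p.rangeRestrict
    ((LinearMap.inr R X Y ∘ₗ π).codRestrict (LinearMap.range p) fun x => by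
      rw [hp]; exact ⟨X'.zero_mem, LinearMap.mem_range_self π x⟩)
    p.surjective_rangeRestrict
  have hs' : ∀ x, p (s x) = (0, π x) := fun x => congrArg Subtype.val (LinearMap.congr_fun hs x)
  -- `q ∘ s` is the identity modulo `ker π ⊆ 𝔪 H`, hence an automorphism of `H`
  have hsurj : Function.Surjective (q ∘ₗ s) := by
    rw [← LinearMap.range_eq_top, ← top_le_iff]
    refine Submodule.le_of_le_smul_of_le_jacobson_bot (I := maximalIdeal R) Module.Finite.fg_top
      (maximalIdeal_le_jacobson _) fun x _ => ?_
    rw [← add_sub_cancel (q (s x)) x]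
    refine Submodule.add_mem_sup ⟨x, rfl⟩ (hπ ?_)
    rw [LinearMap.mem_ker, map_sub, hq', hs', sub_self]
  let a : H ≃ₗ[R] H := LinearEquiv.ofBijective (q ∘ₗ s)
    ⟨OrzechProperty.injective_of_surjective_endomorphism _ hsurj, hsurj⟩
  have ha : ∀ x, q (s (a.symm x)) = x := fun x => a.apply_symm_apply x
  have hπa : ∀ x, π (a.symm x) = π x := fun x => by
    conv_rhs => rw [← ha x, hq', hs']
  have hps : ∀ x, p (s (a.symm x)) = (0, π x) := fun x => by rw [hs', hπa]
  have hproj : ∀ x, x - s (a.symm (q x)) ∈ LinearMap.ker q := fun x => by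
    rw [LinearMap.mem_ker, map_sub, ha, sub_self]
  let pr : F →ₗ[R] LinearMap.ker q :=
    (LinearMap.id - s ∘ₗ a.symm.toLinearMap ∘ₗ q).codRestrict _ hproj
  have hpr : ∀ x : LinearMap.ker q, pr x = x := fun x => Subtype.ext (by
    have h : q x = 0 := x.2
    change (x : F) - s (a.symm (q x)) = x
    rw [h, map_zero, map_zero, sub_zero])
  have : Module.Finite R (LinearMap.ker q) :=
    Module.Finite.of_surjective pr fun x => ⟨x, hpr x⟩
  have : Module.Projective R (LinearMap.ker q) :=
    .of_split (LinearMap.ker q).subtype pr (LinearMap.ext hpr)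
  have : Module.Free R (LinearMap.ker q) := Module.free_of_flat_of_isLocalRing
  let b := (Module.finBasis R (LinearMap.ker q)).equivFun
  let e₀ : F ≃ₗ[R] LinearMap.ker q × H :=
    LinearEquiv.ofLinearMap (pr.prod q)
      ((LinearMap.ker q).subtype.coprod (s ∘ₗ a.symm.toLinearMap))
      (LinearMap.ext fun x => by
        have h : q x.1 = 0 := x.1.2
        have h2 : q (x.1 + s (a.symm x.2)) = x.2 := by rw [map_add, h, ha, zero_add]
        refine Prod.ext (Subtype.ext ?_) h2
        change (x.1 + s (a.symm x.2)) - s (a.symm (q (x.1 + s (a.symm x.2)))) = (x.1 : F)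
        rw [h2, add_sub_cancel_right])
      (LinearMap.ext fun x => sub_add_cancel x (s (a.symm (q x))))
  have hval : ∀ x, p x = ((p (pr x)).1, π (q x)) := fun x => by
    refine Prod.ext ?_ (hq' x).symm
    change _ = (p (x - s (a.symm (q x)))).1
    rw [map_sub, hps, Prod.fst_sub, sub_zero]
  refine ⟨_, e₀.trans (b.prodCongr (.refl R H)),
    LinearMap.fst R X Y ∘ₗ p ∘ₗ (LinearMap.ker q).subtype ∘ₗ b.symm.toLinearMap, fun x => ?_, ?_⟩
  · rw [hval x]
    change _ = ((p (b.symm (b (pr x)))).1, π (q x))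
    rw [b.symm_apply_apply]
  · refine le_antisymm ?_ fun x hx => ?_
    · rintro _ ⟨x, rfl⟩
      exact (hmem _).1
    · have h : (x, (0 : Y)) ∈ LinearMap.range p := by
        rw [hp]; exact ⟨hx, Submodule.zero_mem _⟩
      obtain ⟨y, hy⟩ := h
      refine ⟨b (pr y), ?_⟩
      change (p (b.symm (b (pr y)))).1 = x
      rw [b.symm_apply_apply]
      exact (congrArg Prod.fst ((hval y).symm.trans hy))

lemma LinearEquiv.range_comp_eq_ker_prod_ker {R F F' A H X Y : Type*} [CommRing R]
    [AddCommGroup F] [Module R F] [AddCommGroup F'] [Module R F'] [AddCommGroup A] [Module R A]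
    [AddCommGroup H] [Module R H] [AddCommGroup X] [Module R X] [AddCommGroup Y] [Module R Y]
    {d : F' →ₗ[R] F} {p : F →ₗ[R] X × Y} (hd : LinearMap.ker p = LinearMap.range d)
    (e : F ≃ₗ[R] A × H) {p' : A →ₗ[R] X} {f : H →ₗ[R] Y}
    (hp : ∀ x, p x = (p' (e x).1, f (e x).2)) :
    LinearMap.range (e.toLinearMap ∘ₗ d) = (LinearMap.ker p').prod (LinearMap.ker f) := by
  rw [LinearMap.range_comp, ← hd]
  ext y
  rw [Submodule.mem_map_equiv, LinearMap.mem_ker, hp, e.apply_symm_apply]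
  simp

/-- A minimal free resolution `H` of a direct summand splits off from any resolution by finite free
modules, degree by degree, and leaves a resolution of the complementary summand. -/
lemma exists_linearEquiv_prod_of_exact {R : Type u} [CommRing R] [IsLocalRing R]
    [IsNoetherianRing R] {X Y : Type*} [AddCommGroup X] [Module R X] [AddCommGroup Y] [Module R Y]
    {H : ℕ → Type u} [∀ j, AddCommGroup (H j)] [∀ j, Module R (H j)] [∀ j, Module.Finite R (H j)]
    [∀ j, Module.Projective R (H j)] {n : ℕ → ℕ}
    (d : ∀ j, (Fin (n (j + 1)) → R) →ₗ[R] (Fin (n j) → R)) (g : (Fin (n 0) → R) →ₗ[R] X × Y)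
    (hd : ∀ j, LinearMap.ker (d j) = LinearMap.range (d (j + 1)))
    (hg : LinearMap.ker g = LinearMap.range (d 0))
    (δ : ∀ j, H (j + 1) →ₗ[R] H j) (π : H 0 →ₗ[R] Y)
    (hδ : ∀ j, LinearMap.ker (δ j) = LinearMap.range (δ (j + 1)))
    (hπ : LinearMap.ker π = LinearMap.range (δ 0))
    (hmin : ∀ j, LinearMap.range (δ j) ≤ maximalIdeal R • ⊤)
    (X' : Submodule R X) (hX' : LinearMap.range g = X'.prod (LinearMap.range π)) :
    ∃ (k : ℕ → ℕ) (e : ∀ j, (Fin (n j) → R) ≃ₗ[R] (Fin (k j) → R) × H j)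
      (d' : ∀ j, (Fin (k (j + 1)) → R) →ₗ[R] (Fin (k j) → R)) (g' : (Fin (k 0) → R) →ₗ[R] X),
      (∀ j x, e j (d j x) = (d' j (e (j + 1) x).1, δ j (e (j + 1) x).2)) ∧
      (∀ x, g x = (g' (e 0 x).1, π (e 0 x).2)) ∧
      (∀ j, LinearMap.ker (d' j) = LinearMap.range (d' (j + 1))) ∧
      LinearMap.ker g' = LinearMap.range (d' 0) ∧ LinearMap.range g' = X' := by
  obtain ⟨k₀, e₀, g', hg', hr₀⟩ := exists_linearEquiv_prod_of_range_eq_prod g π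
    (hπ ▸ hmin 0) _ hX'
  let St : ℕ → Type u := fun j =>
    { z : Σ k : ℕ, ((Fin (n j) → R) ≃ₗ[R] (Fin k → R) × H j) × Submodule R (Fin k → R) //
      LinearMap.range (z.2.1.toLinearMap ∘ₗ d j) = z.2.2.prod (LinearMap.range (δ j)) }
  have hstep : ∀ j (s : St j), ∃ (s' : St (j + 1)) (p' : (Fin s'.1.1 → R) →ₗ[R] (Fin s.1.1 → R)),
      (∀ x, s.1.2.1 (d j x) = (p' (s'.1.2.1 x).1, δ j (s'.1.2.1 x).2)) ∧
      LinearMap.range p' = s.1.2.2 ∧ s'.1.2.2 = LinearMap.ker p' := by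
    intro j s
    obtain ⟨k, e, p', hp', hr⟩ := exists_linearEquiv_prod_of_range_eq_prod
      (s.1.2.1.toLinearMap ∘ₗ d j) (δ j) ((hδ j).trans_le (hmin (j + 1))) _ s.2
    refine ⟨⟨⟨k, e, LinearMap.ker p'⟩, ?_⟩, p', hp', hr, rfl⟩
    rw [← hδ]
    exact e.range_comp_eq_ker_prod_ker (by rw [LinearEquiv.ker_comp, hd]) hp'
  choose nxt p' hp' hr hX using hstep
  let s₀ : St 0 := ⟨⟨k₀, e₀, LinearMap.ker g'⟩, by
    rw [← hπ]
    exact e₀.range_comp_eq_ker_prod_ker hg hg'⟩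
  let seq : ∀ j, St j := fun j => Nat.rec s₀ nxt j
  exact ⟨fun j => (seq j).1.1, fun j => (seq j).1.2.1, fun j => p' j (seq j), g',
    fun j => hp' j (seq j), hg',
    fun j => (hX j (seq j)).symm.trans (hr (j + 1) (seq (j + 1))).symm, (hr 0 s₀).symm, hr₀⟩

namespace BSeq

variable {R : Type u} [CommRing R] [IsLocalRing R]

lemma MinimalFreeResolution.range_pi_d_le {ι : Type*} [Finite ι] {N : ι → Type v}
    [∀ i, AddCommGroup (N i)] [∀ i, Module R (N i)] (G : ∀ i, MinimalFreeResolution R (N i))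
    (k : ι → ℕ) :
    LinearMap.range (LinearMap.pi fun i => (G i).d (k i) ∘ₗ LinearMap.proj i) ≤
      maximalIdeal R • (⊤ : Submodule R (∀ i, (G i).F (k i))) := by
  classical
  cases nonempty_fintype ι
  rintro _ ⟨x, rfl⟩
  have h : (LinearMap.pi fun i => (G i).d (k i) ∘ₗ LinearMap.proj i) x =
      ∑ i, LinearMap.single R (fun i => (G i).F (k i)) i ((G i).d (k i) (x i)) := by
    funext j
    simp [Finset.sum_apply]
  rw [h]
  refine Submodule.sum_mem _ fun i _ => ?_
  have h1 := (G i).minimal (k i) (LinearMap.mem_range_self _ (x i))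
  have h2 := Submodule.mem_map_of_mem (f := LinearMap.single R (fun i => (G i).F (k i)) i) h1
  rw [Submodule.map_smul''] at h2
  exact Submodule.smul_mono le_rfl le_top h2

lemma MinimalFreeResolution.ker_pi_comp_proj {ι : Type*} {N : ι → Type v}
    [∀ i, AddCommGroup (N i)] [∀ i, Module R (N i)] (G : ∀ i, MinimalFreeResolution R (N i))
    (k : ι → ℕ) {Y : ι → Type*} [∀ i, AddCommGroup (Y i)] [∀ i, Module R (Y i)]
    (f : ∀ i, (G i).F (k i) →ₗ[R] Y i)
    (hf : ∀ i, LinearMap.ker (f i) = LinearMap.range ((G i).d (k i))) :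
    LinearMap.ker (LinearMap.pi fun i => f i ∘ₗ LinearMap.proj i) =
      LinearMap.range (LinearMap.pi fun i => (G i).d (k i) ∘ₗ LinearMap.proj i) := by
  refine le_antisymm (fun x hx => ?_) ?_
  · have h : ∀ i, ∃ y, (G i).d (k i) y = x i := fun i => by
      rw [← LinearMap.mem_range, ← hf]
      exact congrFun hx i
    choose y hy using h
    exact ⟨y, funext hy⟩
  · rintro _ ⟨y, rfl⟩
    refine funext fun i => ?_
    have : (G i).d (k i) (y i) ∈ LinearMap.ker (f i) := hf i ▸ LinearMap.mem_range_self _ _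
    exact this

/-- If `φ` vanishes on `N = ⨁ Ω_{t i}(N i)`, then the sequence is of trivial type: the minimal
resolutions of the `N i` split off degree by degree. -/
lemma BourbakiSequence.isTrivialType_of_forall_eq_zero [IsNoetherianRing R] {r : ℕ}
    {M : Type u} [AddCommGroup M] [Module R M] {I : Ideal R}
    {ι : Type} [Finite ι] {N : ι → Type v} [∀ i, AddCommGroup (N i)] [∀ i, Module R (N i)]
    (G : ∀ i, MinimalFreeResolution R (N i)) (t : ι → ℕ)
    (S : BourbakiSequence R r (M × (∀ i, (G i).Syzygy (t i))) I)
    (h : ∀ y, S.φ (0, y) = 0) : IsTrivialType G t S := by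
  let δ : ∀ j, (∀ i, (G i).F (t i + j + 1)) →ₗ[R] (∀ i, (G i).F (t i + j)) := fun j =>
    LinearMap.pi fun i => (G i).d (t i + j) ∘ₗ LinearMap.proj i
  let π : (∀ i, (G i).F (t i + 0)) →ₗ[R] (∀ i, (G i).Syzygy (t i)) :=
    LinearMap.pi fun i => (G i).toSyzygy (t i) ∘ₗ LinearMap.proj i
  have hδ : ∀ j, LinearMap.range (δ j) ≤ maximalIdeal R • ⊤ := fun j =>
    MinimalFreeResolution.range_pi_d_le G _
  have hπ : LinearMap.ker π = LinearMap.range (δ 0) :=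
    MinimalFreeResolution.ker_pi_comp_proj G (fun i => t i + 0) (fun i => (G i).toSyzygy (t i)) fun i => Submodule.ker_mkQ _
  have hδδ : ∀ j, LinearMap.ker (δ j) = LinearMap.range (δ (j + 1)) := fun j =>
    MinimalFreeResolution.ker_pi_comp_proj G (fun i => t i + j + 1) (fun i => (G i).d (t i + j)) fun i =>
      LinearMap.exact_iff.mp ((G i).exact_d (t i + j))
  have hπs : LinearMap.range π = ⊤ := LinearMap.range_eq_top.mpr fun y => by
    choose x hx using fun i => (Submodule.mkQ_surjective (LinearMap.range ((G i).d (t i)))) (y i)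
    exact ⟨x, funext hx⟩
  have hφ : ∀ y, S.φ y = S.φ (y.1, 0) := fun y => by
    conv_lhs => rw [show y = (y.1, 0) + (0, y.2) by simp]
    rw [map_add, h, add_zero]
  have hrange : LinearMap.range S.g =
      (LinearMap.ker (S.φ ∘ₗ LinearMap.inl R _ _)).prod (LinearMap.range π) := by
    rw [hπs, ← LinearMap.exact_iff.mp S.exact_φ]
    ext y
    simp [hφ y]
  obtain ⟨k, e, d', g', he, hg', hd', hgd', hr⟩ := exists_linearEquiv_prod_of_exact S.d S.g
    (fun j => LinearMap.exact_iff.mp (S.exact_d j)) (LinearMap.exact_iff.mp S.exact_g)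
    (H := fun j => ∀ i, (G i).F (t i + j)) δ π hδδ hπ hδ _ hrange
  refine ⟨{
    rank := k
    rank_eq_zero := fun j hj => ?_
    d := d'
    g := g'
    φ := S.φ ∘ₗ LinearMap.inl R _ _
    exact_d := fun j => LinearMap.exact_iff.mpr (hd' j)
    exact_g := LinearMap.exact_iff.mpr hgd'
    exact_φ := LinearMap.exact_iff.mpr hr.symm
    φ_surjective := fun a => ?_ }, e, he, hg', hφ⟩
  · have h0 := S.rank_eq_zero j hj
    have : IsEmpty (Fin (S.rank j)) := by rw [h0]; infer_instance
    have h1 := (e j).symm.injective.subsingleton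
    have h2 : Subsingleton (Fin (k j) → R) :=
      (LinearMap.inl_injective (R := R) (M₂ := ∀ i, (G i).F (t i + j))).subsingleton
    by_contra hne
    have := congrFun (h2.elim 0 1) ⟨0, Nat.pos_of_ne_zero hne⟩
    simp at this
  · obtain ⟨y, hy⟩ := S.φ_surjective a
    exact ⟨y.1, (hφ y).symm.trans hy⟩

end BSeq

/-! ### Projective dimension along a Bourbaki sequence -/

open CategoryTheory in
lemma hasProjectiveDimensionLT_range_succ {R : Type u} [CommRing R] {F X : Type u} [AddCommGroup F]
    [Module R F] [Module.Free R F] [AddCommGroup X] [Module R X] (f : F →ₗ[R] X) {s : ℕ}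
    (h : HasProjectiveDimensionLT (ModuleCat.of R (LinearMap.ker f)) s) :
    HasProjectiveDimensionLT (ModuleCat.of R (LinearMap.range f)) (s + 1) := by
  have hS := LinearMap.shortExact_shortComplexKer f.surjective_rangeRestrict
  have hF : Projective (ModuleCat.of R F) :=
    ModuleCat.projective_of_free (Module.Free.chooseBasis R F)
  have hker : LinearMap.ker f.rangeRestrict = LinearMap.ker f := f.ker_rangeRestrict
  have h' : HasProjectiveDimensionLT (ModuleCat.of R (LinearMap.ker f.rangeRestrict)) s := by
    rwa [hker]
  exact hS.hasProjectiveDimensionLT_X₃ s h' (hasProjectiveDimensionLT_of_ge _ 1 _ (by omega))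

namespace BSeq

open CategoryTheory

lemma BourbakiSequence.hasProjectiveDimensionLT_range_g {R : Type u} [CommRing R] {r : ℕ}
    (hr : 2 ≤ r) {P : Type u} [AddCommGroup P] [Module R P] {I : Ideal R}
    (S : BourbakiSequence R r P I) :
    HasProjectiveDimensionLT (ModuleCat.of R (LinearMap.range S.g)) (r - 1) := by
  have hd : ∀ k j, j + k = r - 2 →
      HasProjectiveDimensionLT (ModuleCat.of R (LinearMap.range (S.d j))) k := by
    intro k
    induction k with
    | zero =>
      intro j hj
      have h0 := S.rank_eq_zero (j + 1) (by omega)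
      have : IsEmpty (Fin (S.rank (j + 1))) := by rw [h0]; infer_instance
      have : Subsingleton (LinearMap.range (S.d j)) :=
        (S.d j).surjective_rangeRestrict.subsingleton
      exact (ModuleCat.isZero_of_subsingleton _).hasProjectiveDimensionLT_zero
    | succ k ih =>
      intro j hj
      refine hasProjectiveDimensionLT_range_succ (S.d j) ?_
      rw [LinearMap.exact_iff.mp (S.exact_d j)]
      exact ih (j + 1) (by omega)
  obtain ⟨s, rfl⟩ : ∃ s, r = s + 2 := ⟨r - 2, by omega⟩
  refine hasProjectiveDimensionLT_range_succ S.g ?_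
  rw [LinearMap.exact_iff.mp S.exact_g]
  exact hd s 0 (by omega)

namespace MinimalFreeResolution

variable {R : Type u} [CommRing R] [IsLocalRing R] {L : Type v} [AddCommGroup L] [Module R L]

/-- Ascending along the resolution from `Ω_k` to `Ω_0 ≅ L`, the bound on the projective dimension
grows by one at each step. -/
lemma hasProjectiveDimensionLT_syzygy_zero (G : MinimalFreeResolution R L) (k s : ℕ)
    (h : HasProjectiveDimensionLT (ModuleCat.of R (G.Syzygy k)) s) :
    HasProjectiveDimensionLT (ModuleCat.of R (G.Syzygy 0)) (s + k) := by
  induction k generalizing s with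
  | zero => exact h
  | succ k ih =>
    have h1 : HasProjectiveDimensionLT (ModuleCat.of R (LinearMap.range (G.d k))) s :=
      hasProjectiveDimensionLT_of_iso (G.syzygySuccEquiv k).toModuleIso s
    have h2 : HasProjectiveDimensionLT
        (ModuleCat.of R (LinearMap.range (LinearMap.range (G.d k)).mkQ)) (s + 1) :=
      hasProjectiveDimensionLT_range_succ _ (by rwa [Submodule.ker_mkQ])
    have h3 := hasProjectiveDimensionLT_of_iso
      ((LinearEquiv.ofEq _ _ (Submodule.range_mkQ (LinearMap.range (G.d k)))).trans
        Submodule.topEquiv).toModuleIso (s + 1)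
    rw [show s + (k + 1) = s + 1 + k by omega]
    exact ih (s + 1) h3

lemma subsingleton_F (G : MinimalFreeResolution R L) {k : ℕ} (h : Subsingleton (G.Syzygy k)) :
    Subsingleton (G.F k) := by
  have htop : LinearMap.range (G.d k) = ⊤ := Submodule.Quotient.subsingleton_iff.mp h
  have hle : (⊤ : Submodule R (G.F k)) ≤ maximalIdeal R • ⊤ := htop ▸ G.minimal k
  have := Submodule.eq_bot_of_le_smul_of_le_jacobson_bot _ _ Module.Finite.fg_top hle
    (maximalIdeal_le_jacobson _)
  exact (Submodule.subsingleton_iff R).mp (subsingleton_of_bot_eq_top this.symm)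

lemma subsingleton_syzygy (G : MinimalFreeResolution R L) (h : Subsingleton L) (k : ℕ) :
    Subsingleton (G.Syzygy k) := by
  induction k with
  | zero => exact G.syzygyZeroEquiv.injective.subsingleton
  | succ k ih =>
    have := G.subsingleton_F ih
    exact (G.syzygySuccEquiv k).injective.subsingleton

lemma subsingleton_F_zero (G : MinimalFreeResolution R L) (h : Subsingleton L) :
    Subsingleton (G.F 0) :=
  G.subsingleton_F (G.subsingleton_syzygy h 0)

end MinimalFreeResolution

/-- A summand `Ω_{i+1}(L)`, `i < n - r`, with `L` of finite length, of the kernel of `φ` is zero: it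
has projective dimension at most `r - 2`, which bounds that of `L` by `r - 1 + i < n`. -/
lemma BourbakiSequence.subsingleton_syzygy_of_retract {R : Type u} [CommRing R] [IsLocalRing R]
    [IsNoetherianRing R] {rs : List R} (hmem : ∀ x ∈ rs, x ∈ maximalIdeal R)
    (hreg : RingTheory.Sequence.IsRegular R rs) {r : ℕ} (hr : 2 ≤ r) {P : Type u} [AddCommGroup P]
    [Module R P] {I : Ideal R} (S : BourbakiSequence R r P I) {L : Type v} [AddCommGroup L]
    [Module R L] (hL : IsFiniteLength R L) (G : MinimalFreeResolution R L) {i : ℕ}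
    (hi : i + r ≤ rs.length) (a : G.Syzygy (i + 1) →ₗ[R] LinearMap.ker S.φ)
    (b : LinearMap.ker S.φ →ₗ[R] G.Syzygy (i + 1)) (hab : b ∘ₗ a = LinearMap.id) :
    Subsingleton (G.Syzygy (i + 1)) := by
  have hZ : HasProjectiveDimensionLT (ModuleCat.of R (LinearMap.ker S.φ)) (r - 1) := by
    rw [LinearMap.exact_iff.mp S.exact_φ]
    exact S.hasProjectiveDimensionLT_range_g hr
  have hret : Retract (ModuleCat.of R (G.Syzygy (i + 1))) (ModuleCat.of R (LinearMap.ker S.φ)) :=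
    ⟨ModuleCat.ofHom a, ModuleCat.ofHom b, by rw [← ModuleCat.ofHom_comp, hab]; rfl⟩
  have h0 := G.hasProjectiveDimensionLT_syzygy_zero (i + 1) (r - 1)
    (hret.hasProjectiveDimensionLT _)
  have hfl : IsFiniteLength R (G.Syzygy 0) := G.syzygyZeroEquiv.symm.isFiniteLength hL
  have hsub := hfl.subsingleton_of_hasProjectiveDimensionLT hmem hreg
    (hasProjectiveDimensionLT_of_ge _ (r - 1 + (i + 1)) _ (by omega))
  exact G.subsingleton_syzygy G.syzygyZeroEquiv.symm.injective.subsingleton _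

end BSeq

/-! ### b-sequences -/

/-- A nonzero linear map out of `R ^ k` is nonzero on every vector of a suitable basis: add to the
standard basis vectors that it kills one that it does not kill. -/
lemma LinearMap.exists_basis_forall_apply_ne_zero {R : Type*} [CommRing R] {k : ℕ} {X : Type*}
    [AddCommGroup X] [Module R X] (f : (Fin k → R) →ₗ[R] X) (hf : f ≠ 0) :
    ∃ m : Module.Basis (Fin k) R (Fin k → R), ∀ i, f (m i) ≠ 0 := by
  classical
  obtain ⟨i₀, hi₀⟩ : ∃ i, f (Pi.basisFun R (Fin k) i) ≠ 0 := by
    by_contra! h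
    exact hf ((Pi.basisFun R (Fin k)).ext h)
  let E := Pi.basisFun R (Fin k)
  let c : Module.Dual R (Fin k → R) := E.constr ℕ fun i => if f (E i) = 0 then (1 : R) else 0
  have hc : ∀ i, c (E i) = if f (E i) = 0 then (1 : R) else 0 := fun i => E.constr_basis ℕ _ i
  have hc0 : c (E i₀) = 0 := by rw [hc, if_neg hi₀]
  refine ⟨E.map (LinearEquiv.transvection hc0), fun i => ?_⟩
  rw [Module.Basis.map_apply, LinearEquiv.transvection.apply, hc, map_add]
  split_ifs with h
  · rw [h, zero_add, one_smul]; exact hi₀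
  · rw [zero_smul, map_zero, add_zero]; exact h

namespace BSeq

/-- Any lift of `g` through `ε : U → P` yields a b-sequence, once `g ≠ 0`: apart from the condition
`β i ∉ ker ε`, which can be met by choice of the basis, everything follows from `ε ∘ β = g`. -/
lemma BourbakiSequence.exists_isBSequence_of_lift {R : Type u} [CommRing R] {r : ℕ}
    {P : Type v} [AddCommGroup P] [Module R P] {I : Ideal R} (S : BourbakiSequence R r P I)
    {U : Type*} [AddCommGroup U] [Module R U] (ε : U →ₗ[R] P) (hg : S.g ≠ 0)
    (l : (Fin (S.rank 0) → R) →ₗ[R] U) (hl : ε ∘ₗ l = S.g) :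
    ∃ (q : ℕ) (β : Fin q → U), S.IsBSequence ε β ∧
      Submodule.span R (Set.range β) = LinearMap.range l := by
  obtain ⟨m, hm⟩ := LinearMap.exists_basis_forall_apply_ne_zero S.g hg
  have hl' : ∀ x, ε (l x) = S.g x := fun x => LinearMap.congr_fun hl x
  have hspan : Submodule.span R (Set.range fun i => l (m i)) = LinearMap.range l := by
    rw [Set.range_comp' l m, Submodule.span_image, m.span_eq, Submodule.map_top]
  have hconstr : m.constr ℕ (fun i => l (m i)) = l := m.ext fun i => m.constr_basis ℕ _ i
  refine ⟨_, fun i => l (m i), ⟨m, fun i => hl' _, Subtype.val_injective, fun i h => ?_, ?_, ?_, ?_⟩,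
    hspan⟩
  · rw [LinearMap.mem_ker, hl'] at h
    exact hm i h
  · rw [hspan]
    refine le_antisymm (fun x hx => ?_) (sup_le ?_ fun x hx => ?_)
    · have h1 : S.φ (ε x) = 0 := Subtype.ext hx
      obtain ⟨y, hy⟩ := (S.exact_φ _).mp h1
      rw [← add_sub_cancel (l y) x]
      refine Submodule.add_mem_sup ⟨y, rfl⟩ ?_
      rw [LinearMap.mem_ker, map_sub, hl', hy, sub_self]
    · rintro _ ⟨y, rfl⟩
      change ((S.φ (ε (l y)) : I) : R) = 0
      rw [hl', S.exact_φ.apply_apply_eq_zero]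
      rfl
    · change ((S.φ (ε x) : I) : R) = 0
      rw [LinearMap.mem_ker.mp hx, map_zero]
      rfl
  · rw [hspan, hconstr, LinearMap.range_comp, Submodule.range_subtype]
    ext x
    constructor
    · rintro ⟨y, hy, rfl⟩
      exact ⟨⟨y, rfl⟩, (hl' y).trans hy⟩
    · rintro ⟨⟨y, rfl⟩, hy⟩
      exact ⟨y, (hl' y).symm.trans hy, rfl⟩
  · rw [hconstr]
    ext x
    constructor
    · rintro ⟨y, hy, rfl⟩
      exact hy
    · intro hx
      have h1 : S.g x = 0 := by rw [← hl', LinearMap.mem_ker.mp hx, map_zero]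
      exact ⟨⟨x, h1⟩, hx, rfl⟩

lemma BourbakiSequence.IsBSequence.map_span {R : Type u} [CommRing R] {r : ℕ}
    {P : Type v} [AddCommGroup P] [Module R P] {I : Ideal R} {S : BourbakiSequence R r P I}
    {U : Type*} [AddCommGroup U] [Module R U] {ε : U →ₗ[R] P} {q : ℕ} {β : Fin q → U}
    (h : S.IsBSequence ε β) :
    (Submodule.span R (Set.range β)).map ε = LinearMap.ker S.φ := by
  obtain ⟨m, hm, -⟩ := h
  rw [LinearMap.exact_iff.mp S.exact_φ, Submodule.map_span, ← Set.range_comp,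
    show ε ∘ β = S.g ∘ m from funext hm, Set.range_comp, ← Submodule.map_span, m.span_eq,
    Submodule.map_top]

/-- The middle module is never isomorphic to the ideal if it is free on the punctured spectrum. -/
lemma BourbakiSequence.g_ne_zero {R : Type u} [CommRing R] [IsDomain R]
    [IsLocalRing R] [IsNoetherianRing R] {I : Ideal R} {n r : ℕ} (hn : ringKrullDim R = n)
    (hr : 2 ≤ r) (hrn : r < n) (hI : I.height = r) {P : Type*} [AddCommGroup P] [Module R P]
    (hP : Module.IsFreeOnPuncturedSpectrum R P) (S : BourbakiSequence R r P I) : S.g ≠ 0 := by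
  intro hg
  have hker : LinearMap.ker S.φ = ⊥ := by
    rw [LinearMap.exact_iff.mp S.exact_φ, hg, LinearMap.range_zero]
  let e : P ≃ₗ[R] I := .ofBijective S.φ ⟨LinearMap.ker_eq_bot.mp hker, S.φ_surjective⟩
  refine Module.IsFreeOnPuncturedSpectrum.false_of_ideal hn hr hrn hI fun t ht => ?_
  obtain ⟨j, hj⟩ := hP t ht
  exact ⟨j, hj.congr e⟩

/-- If the kernel of a map `φ : M × N → I` to an ideal of a domain is a product, then `φ` vanishes
on one of the factors: `φ(0, y) x - φ(x, 0) y` is in the kernel for `x ∈ M`, `y ∈ N`. -/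
lemma forall_eq_zero_or_forall_eq_zero_of_ker_eq_prod {R : Type*} [CommRing R] [IsDomain R]
    {I : Ideal R} {M N : Type*} [AddCommGroup M] [Module R M] [AddCommGroup N] [Module R N]
    (φ : M × N →ₗ[R] I) (A : Submodule R M) (B : Submodule R N)
    (h : LinearMap.ker φ = A.prod B) : (∀ x, φ (x, 0) = 0) ∨ (∀ y, φ (0, y) = 0) := by
  by_contra! hcon
  obtain ⟨⟨x, hx⟩, y, hy⟩ := hcon
  set a := φ (x, 0) with ha
  set b := φ (0, y) with hb
  have h1 : ((b : R) • x, -((a : R) • y)) ∈ LinearMap.ker φ := by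
    have h2 : ((b : R) • x, -((a : R) • y)) = (b : R) • (x, (0 : N)) - (a : R) • ((0 : M), y) := by
      simp
    rw [LinearMap.mem_ker, h2, map_sub, map_smul, map_smul, ← ha, ← hb, sub_eq_zero]
    exact Subtype.ext (mul_comm _ _)
  rw [h] at h1
  have h3 : ((b : R) • x, (0 : N)) ∈ LinearMap.ker φ := by
    rw [h]; exact ⟨h1.1, B.zero_mem⟩
  have h4 : (b : R) • a = 0 := by
    rw [ha, ← map_smul, Prod.smul_mk, smul_zero]; exact h3
  have h5 : (b : R) * (a : R) = 0 := congrArg Subtype.val h4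
  rcases mul_eq_zero.mp h5 with h6 | h6
  · exact hy (Subtype.ext h6)
  · exact hx (Subtype.ext h6)

/-- For a sequence of trivial type, lifting the two summands separately gives a lift of `g` whose
image splits. -/
lemma BourbakiSequence.IsTrivialType.exists_lift {R : Type u} [CommRing R] [IsLocalRing R] {r : ℕ}
    {M : Type u} [AddCommGroup M] [Module R M] {I : Ideal R}
    {ι : Type} {N : ι → Type v} [∀ i, AddCommGroup (N i)] [∀ i, Module R (N i)] [Finite ι]
    {G : ∀ i, MinimalFreeResolution R (N i)} {t : ι → ℕ}
    {S : BourbakiSequence R r (M × (∀ i, (G i).Syzygy (t i))) I} (h : IsTrivialType G t S)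
    (hT : ∀ T : BourbakiSequence R r M I, T.g ≠ 0) (hN : Nontrivial (∀ i, (G i).Syzygy (t i)))
    {U V : Type*} [AddCommGroup U] [Module R U] [AddCommGroup V] [Module R V]
    (ε : U →ₗ[R] M) (hε : Function.Surjective ε)
    (η : V →ₗ[R] (∀ i, (G i).Syzygy (t i))) (hη : Function.Surjective η) :
    ∃ l : (Fin (S.rank 0) → R) →ₗ[R] U × V, ε.prodMap η ∘ₗ l = S.g ∧
      SplitsNontrivially (LinearMap.range l) := by
  obtain ⟨T, e, -, hg, -⟩ := h
  obtain ⟨a, ha⟩ := Module.projective_lifting_property ε T.g hε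
  let π : (∀ i, (G i).F (t i + 0)) →ₗ[R] (∀ i, (G i).Syzygy (t i)) :=
    LinearMap.pi fun i => (G i).toSyzygy (t i) ∘ₗ LinearMap.proj i
  obtain ⟨b, hb⟩ := Module.projective_lifting_property η π hη
  have hπ : π ≠ 0 := by
    intro h0
    obtain ⟨y, hy⟩ := exists_ne (0 : ∀ i, (G i).Syzygy (t i))
    choose x hx using fun i => (Submodule.mkQ_surjective (LinearMap.range ((G i).d (t i)))) (y i)
    have h1 : π x = y := funext hx
    exact hy (by rw [← h1, h0, LinearMap.zero_apply])
  refine ⟨a.prodMap b ∘ₗ (e 0).toLinearMap, LinearMap.ext fun x => ?_, LinearMap.range a,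
    LinearMap.range b, fun h0 => ?_, fun h0 => ?_, ?_⟩
  · rw [hg x]
    exact Prod.ext (LinearMap.congr_fun ha _) (LinearMap.congr_fun hb _)
  · rw [LinearMap.range_eq_bot.mp h0, LinearMap.comp_zero] at ha
    exact hT T ha.symm
  · rw [LinearMap.range_eq_bot.mp h0, LinearMap.comp_zero] at hb
    exact hπ hb.symm
  · rw [LinearMap.range_comp, LinearEquiv.range, Submodule.map_top, LinearMap.range_prodMap]

end BSeq

theorem theorem2p4 {R : Type u} [CommRing R] [IsRegularLocalRing R]
    (n r : ℕ) (hn : ringKrullDim R = n) (hr : 2 ≤ r) (hrn : r + 1 ≤ n)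
    (I : Ideal R) (hI : BSeq.IsGeneralizedCM I r)
    -- the finite length modules `M_i`, `0 ≤ i ≤ n - r - 1`, and `N_i`, `n - r + 2 ≤ i ≤ n - 1`,
    -- with their minimal free resolutions
    (Mf : Fin (n - r) → Type v) [∀ i, AddCommGroup (Mf i)] [∀ i, Module R (Mf i)]
    (hM : ∀ i, IsFiniteLength R (Mf i))
    (resM : ∀ i, BSeq.MinimalFreeResolution R (Mf i))
    (Nf : Finset.Icc (n - r + 2) (n - 1) → Type w)
    [∀ i, AddCommGroup (Nf i)] [∀ i, Module R (Nf i)]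
    (hN : ∀ i, IsFiniteLength R (Nf i))
    (resN : ∀ i, BSeq.MinimalFreeResolution R (Nf i))
    -- `N = ⨁ Ω_i(N_i)` is nonzero
    (hN0 : Nontrivial (∀ i, (resN i).Syzygy i))
    -- the Bourbaki sequence with middle module `⨁ Ω_{i+1}(M_i) ⊕ ⨁ Ω_i(N_i)`
    (S : BSeq.BourbakiSequence R r
      ((∀ i, (resM i).Syzygy (i + 1)) × (∀ i, (resN i).Syzygy i)) I)
    -- minimal free resolutions `U → M` and `V → N` of the two summands
    (U : BSeq.MinimalFreeResolution R (∀ i, (resM i).Syzygy (i + 1)))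
    (V : BSeq.MinimalFreeResolution R (∀ i, (resN i).Syzygy i)) :
    ¬ BSeq.BourbakiSequence.IsTrivialType resN (fun i => (i : ℕ)) S ↔
      (∃ (q : ℕ) (β : Fin q → U.F 0 × V.F 0), S.IsBSequence (U.aug.prodMap V.aug) β) ∧
      (∀ (q : ℕ) (β : Fin q → U.F 0 × V.F 0), S.IsBSequence (U.aug.prodMap V.aug) β →
        ¬ BSeq.SplitsNontrivially (Submodule.span R (Set.range β))) := by
  obtain ⟨_, rs, hlen, hmem, hreg⟩ := IsRegularLocalRing.isDomain_and_exists_isRegular R hn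
  have hMfree : Module.IsFreeOnPuncturedSpectrum R (∀ i, (resM i).Syzygy (i + 1)) :=
    .pi fun i => (resM i).isFreeOnPuncturedSpectrum_syzygy (hM i) _
  have hNfree : Module.IsFreeOnPuncturedSpectrum R (∀ i, (resN i).Syzygy i) :=
    .pi fun i => (resN i).isFreeOnPuncturedSpectrum_syzygy (hN i) _
  have hg : S.g ≠ 0 := S.g_ne_zero hn hr hrn hI.height_eq (hMfree.prod hNfree)
  constructor
  · intro hnt
    constructor
    · have hsurj : Function.Surjective (U.aug.prodMap V.aug) :=
        U.aug_surjective.prodMap V.aug_surjective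
      obtain ⟨l, hl⟩ := Module.projective_lifting_property (U.aug.prodMap V.aug) S.g hsurj
      obtain ⟨q, β, hβ, -⟩ := S.exists_isBSequence_of_lift _ hg l hl
      exact ⟨q, β, hβ⟩
    · rintro q β hβ ⟨A, B, hA, -, hAB⟩
      have hker : LinearMap.ker S.φ = (A.map U.aug).prod (B.map V.aug) := by
        rw [← hβ.map_span, hAB]
        ext x
        constructor
        · rintro ⟨y, hy, rfl⟩
          exact ⟨⟨_, hy.1, rfl⟩, ⟨_, hy.2, rfl⟩⟩
        · rintro ⟨⟨y, hy, hyx⟩, ⟨z, hz, hzx⟩⟩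
          exact ⟨(y, z), ⟨hy, hz⟩, Prod.ext hyx hzx⟩
      rcases BSeq.forall_eq_zero_or_forall_eq_zero_of_ker_eq_prod _ _ _ hker with h0 | h0
      · -- `φ` vanishes on `M`: each `Ω_{i+1}(M_i)` is a summand of `ker φ`, so `M = 0`
        classical
        have hsub : ∀ i, Subsingleton ((resM i).Syzygy (i + 1)) := fun i => by
          refine S.subsingleton_syzygy_of_retract hmem hreg hr (hM i) (resM i) (by omega)
            ((LinearMap.inl R _ _ ∘ₗ
              LinearMap.single R (fun i => (resM i).Syzygy (i + 1)) i).codRestrict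
                (LinearMap.ker S.φ) fun x => h0 _)
            (LinearMap.proj i ∘ₗ LinearMap.fst R _ _ ∘ₗ (LinearMap.ker S.φ).subtype) ?_
          exact LinearMap.ext fun x => Pi.single_eq_same (M := fun i => (resM i).Syzygy (i + 1)) i x
        have hU := U.subsingleton_F_zero inferInstance
        exact hA (Subsingleton.elim _ _)
      · exact hnt (S.isTrivialType_of_forall_eq_zero resN _ h0)
  · rintro ⟨-, hns⟩ ht
    obtain ⟨l, hl, hsplit⟩ := ht.exists_lift
      (fun T => T.g_ne_zero hn hr hrn hI.height_eq hMfree) hN0 U.aug U.aug_surjective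
      V.aug V.aug_surjective
    obtain ⟨q, β, hβ, hspan⟩ := S.exists_isBSequence_of_lift _ hg l hl
    exact hns q β hβ (hspan ▸ hsplit)
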